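/- Let $d,N\in\mathbb N$. For a Euclidean space $X$ let $\mathcal P_2(X)$ be the set of Borel probability measures on $X$ with finite second moment, let $\Gamma(\mu,\nu)$ be the set of couplings of $\mu,\nu\in\mathcal P_2(X)$, let $W_2(\mu,\nu)=\big(\inf_{\gamma\in\Gamma(\mu,\nu)}\int|x-y|^2\,d\gamma(x,y)\big)^{1/2}$, and let $\Gamma_o(\mu,\nu)\subseteq\Gamma(\mu,\nu)$ be the set of couplings minimizing $\int|x-y|^2\,d\gamma$. For a set $A\subseteq\mathcal P_2(X)$ put $\Gamma_o(\mu,A)=\bigcup_{\nu\in A}\Gamma_o(\mu,\nu)$. For a finite Borel measure $\mathbb Q$ on $\mathcal P_2(\mathbb R^d)$ let $$\mathrm{Bar}(\mathbb Q)=\operatorname*{argmin}_{\nu\in\mathcal P_2(\mathbb R^d)}\int W_2^2(\sigma,\nu)\,\mathbb Q(d\sigma).$$ Let $\lambda:\mathcal P_2(\mathbb R^d)\to(0,\infty)$ be bounded and continuous with respect to $W_2$. For $\mu\in\mathcal P_2((\mathbb R^d)^N)$ with marginals $\mu^1,\dots,\mu^N\in\mathcal P_2(\mathbb R^d)$ let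 $\mathbb P_\mu=\frac1N\sum_{i=1}^N\delta_{\mu^i}$, let $\lambda\mathbb P_\mu$ be the measure with density $\lambda$ with respect to $\mathbb P_\mu$, and define the multivalued probability vector field $\mathcal V:\mathcal P_2((\mathbb R^d)^N)\rightrightarrows\mathcal P_2(\mathrm T(\mathbb R^d)^N)$, where $\mathrm T(\mathbb R^d)^N=(\mathbb R^d)^N\times(\mathbb R^d)^N\cong(\mathrm T\mathbb R^d)^N$, by $$\mathcal V[\mu]=\bigotimes_{i=1}^N(\pi_0,\pi_1-\pi_0)_\#\Gamma_o\big(\mu^i,\mathrm{Bar}(\lambda\mathbb P_\mu)\big)=\Big\{\bigotimes_{i=1}^N(\pi_0,\pi_1-\pi_0)_\#\gamma^i:\ \gamma^i\in\Gamma_o\big(\mu^i,\mathrm{Bar}(\lambda\mathbb P_\mu)\big),\ i=1,\dots,N\Big\},$$ where $\pi_0(x,y)=x$ and $\pi_1(x,y)=y$. Then $\mathcal V$ is upper semicontinuous, i.e. its graph is closed: if $\mu_n\to\mu$ in $(\mathcal P_2((\mathbb R^d)^N),W_2)$, $\rho_n\to\rho$ in $(\mathcal P_2(\mathrm T(\mathbb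 R^d)^N),W_2)$ and $\rho_n\in\mathcal V[\mu_n]$ for all $n$, then $\rho\in\mathcal V[\mu]$. The same holds for the variant of $\mathcal V$ in which all the $\gamma^i$ are required to be optimal couplings of $\mu^i$ with one common barycenter $\nu\in\mathrm{Bar}(\lambda\mathbb P_\mu)$. -/

import Mathlib

open MeasureTheory Filter Topology
open scoped ENNReal BoundedContinuousFunction

/-- The space `𝒫₂(X)` of Borel probability measures on `X` with finite second moment. -/
@[ext]
structure P2 (X : Type*) [NormedAddCommGroup X] [MeasurableSpace X] where
  /-- the underlying Borel measure -/
  toMeasure : Measure X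
  isProbabilityMeasure : IsProbabilityMeasure toMeasure
  secondMoment_lt_top : ∫⁻ x, ‖x‖ₑ ^ 2 ∂toMeasure < ⊤

section Transport

variable {X : Type*} [NormedAddCommGroup X] [MeasurableSpace X]

/-- The set `Γ(μ, ν)` of couplings: measures on `X × X` with marginals `μ` and `ν`
(these are automatically probability measures). -/
def couplings (μ ν : P2 X) : Set (Measure (X × X)) :=
  {γ | γ.map Prod.fst = μ.toMeasure ∧ γ.map Prod.snd = ν.toMeasure}

/-- The quadratic transport cost `∫ |x - y|² dγ(x, y)` of a plan `γ`. -/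
noncomputable def quadraticCost (γ : Measure (X × X)) : ℝ≥0∞ :=
  ∫⁻ p, ‖p.1 - p.2‖ₑ ^ 2 ∂γ

/-- The `2`-Wasserstein distance, with values in `[0, ∞]`
(it is in fact finite, because of the finite second moments). -/
noncomputable def W2 (μ ν : P2 X) : ℝ≥0∞ :=
  (⨅ γ ∈ couplings μ ν, quadraticCost γ) ^ (1 / 2 : ℝ)

/-- The set `Γ_o(μ, ν)` of optimal couplings for the quadratic cost. -/
def optimalCouplings (μ ν : P2 X) : Set (Measure (X × X)) :=
  {γ | γ ∈ couplings μ ν ∧ IsMinOn quadraticCost (couplings μ ν) γ}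

/-- `Γ_o(μ, A)` for a set `A` of measures: the optimal couplings of `μ` with some element
of `A`. -/
def optimalCouplingsSet (μ : P2 X) (A : Set (P2 X)) : Set (Measure (X × X)) :=
  ⋃ ν ∈ A, optimalCouplings μ ν

/-- The topology of `𝒫₂(X)` induced by the Wasserstein distance: a set is open if with each of its
points it contains a Wasserstein ball around that point. -/
instance P2.instTopologicalSpace : TopologicalSpace (P2 X) where
  IsOpen U := ∀ μ ∈ U, ∃ ε : ℝ≥0∞, 0 < ε ∧ ∀ ν, W2 μ ν < ε → ν ∈ U
  isOpen_univ := fun _ _ => ⟨1, one_pos, fun _ _ => trivial⟩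
  isOpen_inter := by
    rintro U V hU hV μ ⟨hμU, hμV⟩
    obtain ⟨ε, hε, hεU⟩ := hU μ hμU
    obtain ⟨δ, hδ, hδV⟩ := hV μ hμV
    exact ⟨min ε δ, lt_min hε hδ, fun ν hν =>
      ⟨hεU ν (hν.trans_le (min_le_left _ _)), hδV ν (hν.trans_le (min_le_right _ _))⟩⟩
  isOpen_sUnion := by
    rintro S hS μ ⟨U, hUS, hμU⟩
    obtain ⟨ε, hε, hεU⟩ := hS U hUS μ hμU
    exact ⟨ε, hε, fun ν hν => ⟨U, hUS, hεU ν hν⟩⟩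

/-- `𝒫₂(X)` carries the Borel `σ`-algebra of the Wasserstein topology. -/
instance P2.instMeasurableSpace : MeasurableSpace (P2 X) := borel (P2 X)

/-- The set `Bar(ℚ)` of Wasserstein barycenters of a measure `ℚ` on `𝒫₂(X)`: the minimizers over
`ν ∈ 𝒫₂(X)` of `∫ W₂²(σ, ν) dℚ(σ)`. -/
def Bar (Q : Measure (P2 X)) : Set (P2 X) :=
  {ν | IsMinOn (fun ν' : P2 X => ∫⁻ σ, W2 σ ν' ^ 2 ∂Q) Set.univ ν}

/-- Convergence of a sequence in the Wasserstein distance. -/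
def ConvergesW2 (μ : ℕ → P2 X) (μ' : P2 X) : Prop :=
  Tendsto (fun n => W2 (μ n) μ') atTop (𝓝 0)

/-- Upper semicontinuity of a multivalued map between Wasserstein spaces: its graph is
(sequentially) closed. -/
def UpperSemicontinuousMV {Y : Type*} [NormedAddCommGroup Y] [MeasurableSpace Y]
    (F : P2 X → Set (P2 Y)) : Prop :=
  ∀ (μ : ℕ → P2 X) (ρ : ℕ → P2 Y) (μ' : P2 X) (ρ' : P2 Y),
    ConvergesW2 μ μ' → ConvergesW2 ρ ρ' → (∀ n, ρ n ∈ F (μ n)) → ρ' ∈ F μ'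

end Transport

/-- `ℝᵈ` with the Euclidean norm. -/
abbrev Rd (d : ℕ) : Type := EuclideanSpace ℝ (Fin d)

/-- `(ℝᵈ)ᴺ` with the Euclidean norm. -/
abbrev RdN (d N : ℕ) : Type := PiLp 2 (fun _ : Fin N => Rd d)

/-- The tangent bundle `T(ℝᵈ)ᴺ = (ℝᵈ)ᴺ × (ℝᵈ)ᴺ` with the Euclidean norm; its elements are pairs
(position, velocity). -/
abbrev TRdN (d N : ℕ) : Type := WithLp 2 (RdN d N × RdN d N)

/-- The `i`-th marginal `μⁱ = (pᵢ)_# μ` of `μ ∈ 𝒫₂((ℝᵈ)ᴺ)`. -/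
noncomputable def P2.marginal {d N : ℕ} (μ : P2 (RdN d N)) (i : Fin N) : P2 (Rd d) where
  toMeasure := μ.toMeasure.map (fun x => x i)
  isProbabilityMeasure :=
    haveI := μ.isProbabilityMeasure
    Measure.isProbabilityMeasure_map (by fun_prop)
  secondMoment_lt_top := by
    rw [lintegral_map (by fun_prop) (by fun_prop)]
    refine lt_of_le_of_lt (lintegral_mono fun x => ?_) μ.secondMoment_lt_top
    gcongr
    exact enorm_le_iff_norm_le.mpr (PiLp.norm_apply_le x i)

/-- The empirical measure `ℙ_μ = (1/N) ∑ᵢ δ_{μⁱ}` on `𝒫₂(ℝᵈ)` of `μ ∈ 𝒫₂((ℝᵈ)ᴺ)`. -/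
noncomputable def empirical {d N : ℕ} (μ : P2 (RdN d N)) : Measure (P2 (Rd d)) :=
  (N : ℝ≥0∞)⁻¹ • ∑ i, Measure.dirac (μ.marginal i)

/-- The weighted measure `λ ℚ`, with density `λ` with respect to `ℚ`. -/
noncomputable def weighted {d : ℕ} (lam : P2 (Rd d) →ᵇ ℝ) (Q : Measure (P2 (Rd d))) :
    Measure (P2 (Rd d)) :=
  Q.withDensity (fun σ => ENNReal.ofReal (lam σ))

/-- The push-forward `(π₀, π₁ - π₀)_# γ`, a measure on `Tℝᵈ = ℝᵈ × ℝᵈ`. -/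
noncomputable def velocityPlan {d : ℕ} (γ : Measure (Rd d × Rd d)) : Measure (Rd d × Rd d) :=
  γ.map (fun p => (p.1, p.2 - p.1))

/-- The identification of `(Tℝᵈ)ᴺ` with `T(ℝᵈ)ᴺ`,
`((x₁, v₁), …, (x_N, v_N)) ↦ ((x₁, …, x_N), (v₁, …, v_N))`. -/
noncomputable def tangentIdent {d N : ℕ} (z : Fin N → Rd d × Rd d) : TRdN d N :=
  WithLp.toLp 2 (WithLp.toLp 2 (fun i => (z i).1), WithLp.toLp 2 (fun i => (z i).2))

/-- The product `⨂ᵢ ηᵢ` of measures `ηᵢ` on `Tℝᵈ`, as a measure on `T(ℝᵈ)ᴺ`. -/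
noncomputable def tensor {d N : ℕ} (η : Fin N → Measure (Rd d × Rd d)) : Measure (TRdN d N) :=
  (Measure.pi η).map tangentIdent

/-- The multivalued probability vector field
`𝒱[μ] = ⨂ᵢ (π₀, π₁ - π₀)_# Γ_o(μⁱ, Bar(λ ℙ_μ))`: the product of the sets
`(π₀, π₁ - π₀)_# Γ_o(μⁱ, Bar(λ ℙ_μ))`. -/
def multiVF {d N : ℕ} (lam : P2 (Rd d) →ᵇ ℝ) (μ : P2 (RdN d N)) : Set (P2 (TRdN d N)) :=
  {ρ | ∃ γ : Fin N → Measure (Rd d × Rd d),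
    (∀ i, γ i ∈ optimalCouplingsSet (μ.marginal i) (Bar (weighted lam (empirical μ)))) ∧
    ρ.toMeasure = tensor (fun i => velocityPlan (γ i))}

/-- The variant of `multiVF` in which all agents use one common barycenter
`ν ∈ Bar(λ ℙ_μ)`. The two differ only if the barycenter is not unique. -/
def multiVFCommon {d N : ℕ} (lam : P2 (Rd d) →ᵇ ℝ) (μ : P2 (RdN d N)) : Set (P2 (TRdN d N)) :=
  {ρ | ∃ ν ∈ Bar (weighted lam (empirical μ)), ∃ γ : Fin N → Measure (Rd d × Rd d),
    (∀ i, γ i ∈ optimalCouplings (μ.marginal i) ν) ∧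
    ρ.toMeasure = tensor (fun i => velocityPlan (γ i))}

open scoped ProbabilityTheory

/-! The graph is closed because membership $\rho\in\mathcal V[\mu]$ can be rewritten as conditions
on $\rho$ itself that pass to Wasserstein limits. The plan $\gamma^i$ is recovered from $\rho$ by
$(x,v)\mapsto(x^i,x^i+v^i)$, so its marginals are images of $\rho$ under continuous linear maps,
which act Lipschitz-continuously for $W_2$. In particular the barycenters used along the sequence
converge because $\rho_n$ does, and no compactness argument is needed.

Three conditions remain. Optimality says that the second moment of $v^i$, which is a squared
distance to $\delta_0$, is at most the squared distance between the marginals of $\gamma^i$; both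
sides are continuous (`componentPlan_mem_optimalCouplings_iff`). The barycenter property compares
finite sums that are jointly continuous in the measures (`mem_Bar_of_convergesW2`). The product
structure is a fixed-point equation for a weakly continuous map (`eq_tensor_of_convergesW2`). -/

instance P2.instIsProbabilityMeasure {X : Type*} [NormedAddCommGroup X] [MeasurableSpace X]
    (μ : P2 X) : IsProbabilityMeasure μ.toMeasure :=
  μ.isProbabilityMeasure

/-! ### Wasserstein distance: metric properties and weak convergence. -/

section Basic

variable {X : Type*} [NormedAddCommGroup X] [MeasurableSpace X]

theorem isProbabilityMeasure_of_mem_couplings {μ ν : P2 X} {γ : Measure (X × X)}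
    (h : γ ∈ couplings μ ν) : IsProbabilityMeasure γ := by
  constructor
  have : γ.map Prod.fst Set.univ = 1 := by rw [h.1]; exact measure_univ
  rwa [Measure.map_apply measurable_fst MeasurableSet.univ] at this

/-- Writing the cost as an $L^2$ norm makes Minkowski's inequality available. -/
theorem quadraticCost_rpow_half (γ : Measure (X × X)) :
    quadraticCost γ ^ (1 / 2 : ℝ) = eLpNorm (fun p : X × X => p.1 - p.2) 2 γ := by
  rw [eLpNorm_eq_lintegral_rpow_enorm_toReal (by norm_num) (by norm_num)]
  simp [quadraticCost]

theorem W2_le_eLpNorm {μ ν : P2 X} {γ : Measure (X × X)} (h : γ ∈ couplings μ ν) :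
    W2 μ ν ≤ eLpNorm (fun p : X × X => p.1 - p.2) 2 γ := by
  rw [← quadraticCost_rpow_half]
  exact ENNReal.rpow_le_rpow (iInf₂_le γ h) (by norm_num)

theorem exists_coupling_eLpNorm_lt {μ ν : P2 X} {c : ℝ≥0∞} (h : W2 μ ν < c) :
    ∃ γ ∈ couplings μ ν, eLpNorm (fun p : X × X => p.1 - p.2) 2 γ < c := by
  have hc : c = (c ^ (2 : ℝ)) ^ (1 / 2 : ℝ) := by rw [← ENNReal.rpow_mul]; norm_num
  rw [hc, W2, ENNReal.rpow_lt_rpow_iff (by norm_num)] at h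
  simp only [iInf_lt_iff] at h
  obtain ⟨γ, hγ, hlt⟩ := h
  refine ⟨γ, hγ, ?_⟩
  rw [← quadraticCost_rpow_half, hc]
  exact ENNReal.rpow_lt_rpow hlt (by norm_num)

theorem le_W2 {μ ν : P2 X} {c : ℝ≥0∞}
    (h : ∀ γ ∈ couplings μ ν, c ≤ eLpNorm (fun p : X × X => p.1 - p.2) 2 γ) : c ≤ W2 μ ν := by
  by_contra! hlt
  obtain ⟨γ, hγ, hγc⟩ := exists_coupling_eLpNorm_lt hlt
  exact (h γ hγ).not_gt hγc

theorem mem_optimalCouplings_iff {μ ν : P2 X} {γ : Measure (X × X)} :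
    γ ∈ optimalCouplings μ ν ↔
      γ ∈ couplings μ ν ∧ eLpNorm (fun p : X × X => p.1 - p.2) 2 γ ≤ W2 μ ν := by
  refine and_congr_right fun _ => ?_
  rw [← quadraticCost_rpow_half, W2, ENNReal.rpow_le_rpow_iff (by norm_num), isMinOn_iff,
    le_iInf₂_iff]

theorem swap_mem_couplings {μ ν : P2 X} {γ : Measure (X × X)} (h : γ ∈ couplings μ ν) :
    γ.map Prod.swap ∈ couplings ν μ := by
  refine ⟨?_, ?_⟩
  · rw [Measure.map_map measurable_fst measurable_swap]; exact h.2
  · rw [Measure.map_map measurable_snd measurable_swap]; exact h.1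

theorem P2.eLpNorm_id_lt_top (μ : P2 X) : eLpNorm (fun x : X => x) 2 μ.toMeasure < ⊤ := by
  rw [eLpNorm_eq_lintegral_rpow_enorm_toReal (by norm_num) (by norm_num)]
  refine ENNReal.rpow_lt_top_of_nonneg (by norm_num) ?_
  simpa using μ.secondMoment_lt_top.ne

theorem P2.isOpen_iff {U : Set (P2 X)} :
    IsOpen U ↔ ∀ μ ∈ U, ∃ ε : ℝ≥0∞, 0 < ε ∧ ∀ ν, W2 μ ν < ε → ν ∈ U :=
  Iff.rfl

variable [BorelSpace X] [SecondCountableTopology X]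

theorem W2_comm_le (μ ν : P2 X) : W2 μ ν ≤ W2 ν μ := by
  refine le_W2 fun γ hγ => (W2_le_eLpNorm (swap_mem_couplings hγ)).trans_eq ?_
  rw [eLpNorm_map_measure (by fun_prop) (by fun_prop)]
  exact eLpNorm_sub_comm _ _ _ _

theorem W2_comm (μ ν : P2 X) : W2 μ ν = W2 ν μ :=
  (W2_comm_le μ ν).antisymm (W2_comm_le ν μ)

theorem W2_ne_top (μ ν : P2 X) : W2 μ ν ≠ ⊤ := by
  have hmem : μ.toMeasure.prod ν.toMeasure ∈ couplings μ ν :=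
    ⟨by simp [Measure.map_fst_prod], by simp [Measure.map_snd_prod]⟩
  refine ne_top_of_le_ne_top ?_ (W2_le_eLpNorm hmem)
  have h1 : eLpNorm (fun p : X × X => p.1) 2 (μ.toMeasure.prod ν.toMeasure) < ⊤ := by
    have := μ.eLpNorm_id_lt_top
    rwa [← hmem.1, eLpNorm_map_measure (by fun_prop) (by fun_prop)] at this
  have h2 : eLpNorm (fun p : X × X => p.2) 2 (μ.toMeasure.prod ν.toMeasure) < ⊤ := by
    have := ν.eLpNorm_id_lt_top
    rwa [← hmem.2, eLpNorm_map_measure (by fun_prop) (by fun_prop)] at this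
  exact ((eLpNorm_sub_le (by fun_prop) (by fun_prop) (by norm_num)).trans_lt
    (ENNReal.add_lt_top.2 ⟨h1, h2⟩)).ne

/-- The gluing lemma: two couplings with a common marginal are marginals of one measure. -/
theorem exists_gluing [CompleteSpace X] {μ ν σ : P2 X} {γ γ' : Measure (X × X)}
    (h : γ ∈ couplings μ ν) (h' : γ' ∈ couplings ν σ) :
    ∃ π : Measure (X × X × X), π.map (fun p => (p.2.1, p.1)) = γ ∧
      π.map (fun p => (p.1, p.2.2)) = γ' := by
  have hs := swap_mem_couplings h
  have := isProbabilityMeasure_of_mem_couplings hs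
  have := isProbabilityMeasure_of_mem_couplings h'
  -- Both plans are disintegrated over the common marginal `ν`; the outer points are then taken
  -- independent given the middle one, which is the first coordinate of `π`.
  set κ := (γ.map Prod.swap).condKernel
  set κ' := γ'.condKernel
  have hκ : ν.toMeasure ⊗ₘ κ = γ.map Prod.swap := by
    rw [← hs.1]; exact (γ.map Prod.swap).disintegrate κ
  have hκ' : ν.toMeasure ⊗ₘ κ' = γ' := by
    rw [← h'.1]; exact γ'.disintegrate κ'
  refine ⟨ν.toMeasure ⊗ₘ (κ ×ₖ κ'), ?_, ?_⟩
  · have h1 : (ν.toMeasure ⊗ₘ (κ ×ₖ κ')).map (Prod.map id Prod.fst) = γ.map Prod.swap := by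
      rw [← Measure.compProd_map measurable_fst, ← ProbabilityTheory.Kernel.fst_eq,
        ProbabilityTheory.Kernel.fst_prod, hκ]
    have h2 := congrArg (Measure.map Prod.swap) h1
    rw [Measure.map_map measurable_swap (by fun_prop),
      Measure.map_map measurable_swap measurable_swap, Prod.swap_swap_eq, Measure.map_id] at h2
    exact h2
  · have h1 : (ν.toMeasure ⊗ₘ (κ ×ₖ κ')).map (Prod.map id Prod.snd) = γ' := by
      rw [← Measure.compProd_map measurable_snd, ← ProbabilityTheory.Kernel.snd_eq,
        ProbabilityTheory.Kernel.snd_prod, hκ']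
    exact h1

theorem W2_triangle [CompleteSpace X] (μ ν σ : P2 X) : W2 μ σ ≤ W2 μ ν + W2 ν σ := by
  refine ENNReal.le_of_forall_pos_le_add fun ε hε _ => ?_
  -- Plans optimal up to `ε / 2` suffice, so existence of optimal plans is not needed.
  have hε' : (0 : ℝ≥0∞) < ε / 2 := by simpa using hε.ne'
  obtain ⟨γ, hγ, hlt⟩ := exists_coupling_eLpNorm_lt
    (ENNReal.lt_add_right (W2_ne_top μ ν) hε'.ne')
  obtain ⟨γ', hγ', hlt'⟩ := exists_coupling_eLpNorm_lt
    (ENNReal.lt_add_right (W2_ne_top ν σ) hε'.ne')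
  obtain ⟨π, rfl, rfl⟩ := exists_gluing hγ hγ'
  have hmem : π.map (fun p => (p.2.1, p.2.2)) ∈ couplings μ σ := by
    refine ⟨?_, ?_⟩
    · rw [← hγ.1, Measure.map_map (by fun_prop) (by fun_prop),
        Measure.map_map (by fun_prop) (by fun_prop)]
      rfl
    · rw [← hγ'.2, Measure.map_map (by fun_prop) (by fun_prop),
        Measure.map_map (by fun_prop) (by fun_prop)]
      rfl
  rw [eLpNorm_map_measure (by fun_prop) (by fun_prop)] at hlt hlt'
  refine (W2_le_eLpNorm hmem).trans ?_
  rw [eLpNorm_map_measure (by fun_prop) (by fun_prop)]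
  have hadd := eLpNorm_add_le (μ := π) (p := 2)
    (f := (fun p : X × X => p.1 - p.2) ∘ fun p : X × X × X => (p.2.1, p.1))
    (g := (fun p : X × X => p.1 - p.2) ∘ fun p : X × X × X => (p.1, p.2.2))
    (by fun_prop) (by fun_prop) (by norm_num)
  calc _ = _ := by congr 1; ext p; simp
    _ ≤ _ := hadd
    _ ≤ _ := add_le_add hlt.le hlt'.le
    _ = _ := by rw [add_add_add_comm, ENNReal.add_halves]

theorem ConvergesW2.tendsto_W2 [CompleteSpace X] {μ ν : ℕ → P2 X} {μ' ν' : P2 X}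
    (hμ : ConvergesW2 μ μ') (hν : ConvergesW2 ν ν') :
    Tendsto (fun n => W2 (μ n) (ν n)) atTop (𝓝 (W2 μ' ν')) := by
  have hε : Tendsto (fun n => W2 (μ n) μ' + W2 (ν n) ν') atTop (𝓝 0) := by
    simpa using Tendsto.add hμ hν
  have hlow : Tendsto (fun n => W2 μ' ν' - (W2 (μ n) μ' + W2 (ν n) ν')) atTop
      (𝓝 (W2 μ' ν')) := by
    simpa using ENNReal.Tendsto.sub (tendsto_const_nhds (x := W2 μ' ν')) hε
      (Or.inl (W2_ne_top _ _))
  have hup : Tendsto (fun n => W2 μ' ν' + (W2 (μ n) μ' + W2 (ν n) ν')) atTop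
      (𝓝 (W2 μ' ν')) := by
    simpa using Tendsto.add (tendsto_const_nhds (x := W2 μ' ν')) hε
  refine tendsto_of_tendsto_of_tendsto_of_le_of_le hlow hup (fun n => ?_) (fun n => ?_)
  · refine tsub_le_iff_right.2 ?_
    calc W2 μ' ν' ≤ W2 μ' (μ n) + (W2 (μ n) (ν n) + W2 (ν n) ν') :=
        (W2_triangle _ (μ n) _).trans (by gcongr; exact W2_triangle _ _ _)
      _ = _ := by rw [W2_comm μ']; ring
  · calc W2 (μ n) (ν n) ≤ W2 (μ n) μ' + (W2 μ' ν' + W2 ν' (ν n)) :=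
        (W2_triangle _ μ' _).trans (by gcongr; exact W2_triangle _ _ _)
      _ = _ := by rw [W2_comm ν']; ring

theorem le_mul_W2 {μ ν : P2 X} {c : ℝ≥0∞} (K : NNReal)
    (h : ∀ γ ∈ couplings μ ν, c ≤ K * eLpNorm (fun p : X × X => p.1 - p.2) 2 γ) :
    c ≤ K * W2 μ ν := by
  rcases eq_or_ne K 0 with rfl | hK
  · obtain ⟨γ, hγ, -⟩ := exists_coupling_eLpNorm_lt (W2_ne_top μ ν).lt_top
    simpa using h γ hγ
  · have hK0 : (K : ℝ≥0∞) ≠ 0 := by simpa using hK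
    rw [mul_comm, ← ENNReal.div_le_iff_le_mul (Or.inl hK0) (Or.inl ENNReal.coe_ne_top)]
    exact le_W2 fun γ hγ => ENNReal.div_le_of_le_mul ((h γ hγ).trans_eq (mul_comm _ _))

/-- The difference of the integrals is the integral of `f p.1 - f p.2` against any coupling, and the
$L^1$ norm is at most the $L^2$ norm. The bound `C` only serves integrability. -/
theorem edist_integral_le_W2 {μ ν : P2 X} {f : X → ℝ} {C : ℝ} {K : NNReal}
    (hC : ∀ x y, dist (f x) (f y) ≤ C) (hf : LipschitzWith K f) :
    edist (∫ x, f x ∂μ.toMeasure) (∫ x, f x ∂ν.toMeasure) ≤ K * W2 μ ν := by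
  refine le_mul_W2 K fun γ hγ => ?_
  have := isProbabilityMeasure_of_mem_couplings hγ
  have hbdd (σ : P2 X) : Integrable f σ.toMeasure := by
    refine (integrable_const (|f 0| + C)).mono' hf.continuous.aestronglyMeasurable
      (.of_forall fun x => ?_)
    have h0 := hC x 0
    rw [Real.dist_eq] at h0
    have := abs_sub_abs_le_abs_sub (f x) (f 0)
    rw [Real.norm_eq_abs]
    linarith
  have h1 := hbdd μ
  have h2 := hbdd ν
  have hm : AEStronglyMeasurable f (γ.map Prod.fst) := hf.continuous.aestronglyMeasurable
  have hm' : AEStronglyMeasurable f (γ.map Prod.snd) := hf.continuous.aestronglyMeasurable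
  rw [← hγ.1] at h1 ⊢
  rw [← hγ.2] at h2 ⊢
  have h1' : Integrable (fun p : X × X => f p.1) γ := h1.comp_measurable measurable_fst
  have h2' : Integrable (fun p : X × X => f p.2) γ := h2.comp_measurable measurable_snd
  rw [integral_map (by fun_prop) hm, integral_map (by fun_prop) hm',
    edist_eq_enorm_sub, ← integral_sub h1' h2']
  calc ‖∫ p : X × X, f p.1 - f p.2 ∂γ‖ₑ
      ≤ ∫⁻ p : X × X, ‖f p.1 - f p.2‖ₑ ∂γ := enorm_integral_le_lintegral_enorm _
    _ ≤ ∫⁻ p : X × X, K * ‖p.1 - p.2‖ₑ ∂γ := by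
      refine lintegral_mono fun p => ?_
      rw [← edist_eq_enorm_sub, ← edist_eq_enorm_sub]
      exact hf p.1 p.2
    _ = K * eLpNorm (fun p : X × X => p.1 - p.2) 1 γ := by
      rw [lintegral_const_mul _ (by fun_prop), eLpNorm_one_eq_lintegral_enorm]
    _ ≤ _ := by
      gcongr
      exact eLpNorm_le_eLpNorm_of_exponent_le (by norm_num) (by fun_prop)

/-- A measure of `𝒫₂(X)`, as a point of the space of probability measures with the topology of
weak convergence. -/
def P2.toProbabilityMeasure (μ : P2 X) : ProbabilityMeasure X :=
  ⟨μ.toMeasure, μ.isProbabilityMeasure⟩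

theorem ConvergesW2.tendsto_toProbabilityMeasure {μ : ℕ → P2 X} {μ' : P2 X}
    (h : ConvergesW2 μ μ') :
    Tendsto (fun n => (μ n).toProbabilityMeasure) atTop (𝓝 μ'.toProbabilityMeasure) := by
  rw [tendsto_iff_forall_lipschitz_integral_tendsto]
  rintro f ⟨C, hC⟩ ⟨K, hK⟩
  rw [tendsto_iff_edist_tendsto_0]
  have hlim : Tendsto (fun n => K * W2 (μ n) μ') atTop (𝓝 0) := by
    simpa using ENNReal.Tendsto.const_mul h (Or.inr (ENNReal.coe_ne_top (r := K)))
  exact tendsto_of_tendsto_of_tendsto_of_le_of_le tendsto_const_nhds hlim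
    (fun _ => zero_le) (fun n => edist_integral_le_W2 hC hK)

/-- The weak topology is Hausdorff. -/
theorem ConvergesW2.unique {μ : ℕ → P2 X} {μ' μ'' : P2 X}
    (h' : ConvergesW2 μ μ') (h'' : ConvergesW2 μ μ'') : μ' = μ'' := by
  have h := tendsto_nhds_unique h'.tendsto_toProbabilityMeasure h''.tendsto_toProbabilityMeasure
  exact P2.ext (congrArg Subtype.val h)

theorem W2_self (μ : P2 X) : W2 μ μ = 0 := by
  have hmem : μ.toMeasure.map (fun x => (x, x)) ∈ couplings μ μ := by
    constructor <;>
    · rw [Measure.map_map (by fun_prop) (by fun_prop)]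
      exact Measure.map_id
  refine nonpos_iff_eq_zero.1 ((W2_le_eLpNorm hmem).trans_eq ?_)
  rw [eLpNorm_map_measure (by fun_prop) (by fun_prop)]
  simp [Function.comp_def]

theorem convergesW2_const (μ : P2 X) : ConvergesW2 (fun _ => μ) μ := by
  simp [ConvergesW2, W2_self]

theorem eq_of_W2_eq_zero {μ ν : P2 X} (h : W2 μ ν = 0) : μ = ν :=
  (convergesW2_const μ).unique (μ' := μ) (by simp [ConvergesW2, h])

instance P2.instBorelSpace : BorelSpace (P2 X) := ⟨rfl⟩

/-- Makes singletons measurable, so that integrals against Dirac masses on `P2 X` need no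
measurability of the integrand. -/
instance P2.instT1Space : T1Space (P2 X) := by
  refine ⟨fun μ => ⟨P2.isOpen_iff.2 fun ν hν => ?_⟩⟩
  refine ⟨W2 ν μ, pos_iff_ne_zero.2 fun h => hν (eq_of_W2_eq_zero h), ?_⟩
  rintro σ hσ rfl
  exact hσ.false

theorem ConvergesW2.tendsto {μ : ℕ → P2 X} {μ' : P2 X} (h : ConvergesW2 μ μ') :
    Tendsto μ atTop (𝓝 μ') := by
  refine tendsto_nhds.2 fun U hU hμU => ?_
  obtain ⟨ε, hε, hεU⟩ := P2.isOpen_iff.1 hU μ' hμU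
  filter_upwards [h.eventually_lt_const hε] with n hn
  exact hεU _ (by rwa [W2_comm])

end Basic

/-! ### Second moments as distances to the Dirac mass at the origin. -/

section SecondMoment

variable {X : Type*} [NormedAddCommGroup X] [MeasurableSpace X]

theorem P2.of_eLpNorm_lt_top {μ : Measure X} (h : eLpNorm (fun x : X => x) 2 μ < ⊤) :
    ∫⁻ x, ‖x‖ₑ ^ 2 ∂μ < ⊤ := by
  rw [eLpNorm_eq_lintegral_rpow_enorm_toReal (by norm_num) (by norm_num),
    ENNReal.rpow_lt_top_iff_of_pos (by norm_num)] at h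
  simpa using h

variable [BorelSpace X]

/-- The Dirac mass at the origin. -/
noncomputable def P2.diracZero : P2 X where
  toMeasure := Measure.dirac 0
  isProbabilityMeasure := inferInstance
  secondMoment_lt_top := by
    rw [lintegral_dirac' _ (by fun_prop)]
    simp

variable [SecondCountableTopology X]

theorem W2_diracZero (μ : P2 X) : W2 μ P2.diracZero = eLpNorm (fun x : X => x) 2 μ.toMeasure := by
  have key {γ : Measure (X × X)} (hγ : γ ∈ couplings μ P2.diracZero) :
      eLpNorm (fun p : X × X => p.1 - p.2) 2 γ = eLpNorm (fun x : X => x) 2 μ.toMeasure := by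
    have h0 : ∀ᵐ x ∂(γ.map Prod.snd), x = 0 := by
      rw [hγ.2]
      simp [P2.diracZero, ae_dirac_eq]
    rw [← hγ.1, eLpNorm_map_measure (by fun_prop) (by fun_prop)]
    refine eLpNorm_congr_ae ?_
    filter_upwards [ae_of_ae_map (by fun_prop) h0] with p hp
    simp [hp]
  refine le_antisymm ?_ (le_W2 fun γ hγ => (key hγ).ge)
  obtain ⟨γ, hγ, -⟩ := exists_coupling_eLpNorm_lt (W2_ne_top μ P2.diracZero).lt_top
  exact (W2_le_eLpNorm hγ).trans_eq (key hγ)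

end SecondMoment

/-! ### Push-forward under continuous linear maps. -/

section Map

variable {X Y : Type*} [NormedAddCommGroup X] [NormedSpace ℝ X] [MeasurableSpace X] [BorelSpace X]
  [SecondCountableTopology X] [NormedAddCommGroup Y] [NormedSpace ℝ Y] [MeasurableSpace Y]
  [BorelSpace Y] [SecondCountableTopology Y]

/-- The push-forward of a measure of `𝒫₂(X)` under a continuous linear map. -/
noncomputable def P2.map (g : X →L[ℝ] Y) (μ : P2 X) : P2 Y where
  toMeasure := μ.toMeasure.map g
  isProbabilityMeasure := Measure.isProbabilityMeasure_map (by fun_prop)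
  secondMoment_lt_top := by
    refine P2.of_eLpNorm_lt_top ?_
    rw [eLpNorm_map_measure (by fun_prop) (by fun_prop)]
    exact (eLpNorm_le_nnreal_smul_eLpNorm_of_ae_le_mul (c := ‖g‖₊)
      (.of_forall fun x => g.le_opNNNorm x) 2).trans_lt
      (ENNReal.mul_lt_top ENNReal.coe_lt_top μ.eLpNorm_id_lt_top)

theorem W2_map_le (g : X →L[ℝ] Y) (μ ν : P2 X) :
    W2 (μ.map g) (ν.map g) ≤ ‖g‖₊ * W2 μ ν := by
  refine le_mul_W2 _ fun γ hγ => ?_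
  have hmem : γ.map (fun p => (g p.1, g p.2)) ∈ couplings (μ.map g) (ν.map g) := by
    refine ⟨?_, ?_⟩
    · simp only [P2.map]
      rw [← hγ.1, Measure.map_map (by fun_prop) (by fun_prop),
        Measure.map_map (by fun_prop) (by fun_prop)]
      rfl
    · simp only [P2.map]
      rw [← hγ.2, Measure.map_map (by fun_prop) (by fun_prop),
        Measure.map_map (by fun_prop) (by fun_prop)]
      rfl
  refine (W2_le_eLpNorm hmem).trans ?_
  rw [eLpNorm_map_measure (by fun_prop) (by fun_prop)]
  refine eLpNorm_le_nnreal_smul_eLpNorm_of_ae_le_mul (.of_forall fun p => ?_) 2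
  simpa using g.le_opNNNorm (p.1 - p.2)

theorem ConvergesW2.map (g : X →L[ℝ] Y) {μ : ℕ → P2 X} {μ' : P2 X} (h : ConvergesW2 μ μ') :
    ConvergesW2 (fun n => (μ n).map g) (μ'.map g) := by
  have hlim : Tendsto (fun n => ‖g‖₊ * W2 (μ n) μ') atTop (𝓝 0) := by
    simpa using ENNReal.Tendsto.const_mul h (Or.inr (ENNReal.coe_ne_top (r := ‖g‖₊)))
  exact tendsto_of_tendsto_of_tendsto_of_le_of_le tendsto_const_nhds hlim
    (fun _ => zero_le) (fun n => W2_map_le _ _ _)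

end Map

/-! ### Stability of barycenters. -/

section Barycenter

variable {d N : ℕ} {lam : P2 (Rd d) →ᵇ ℝ}

theorem P2.marginal_eq_map (μ : P2 (RdN d N)) (i : Fin N) :
    μ.marginal i = μ.map (PiLp.proj 2 (fun _ : Fin N => Rd d) i) :=
  rfl

theorem ConvergesW2.marginal {μ : ℕ → P2 (RdN d N)} {μ' : P2 (RdN d N)} (h : ConvergesW2 μ μ')
    (i : Fin N) : ConvergesW2 (fun n => (μ n).marginal i) (μ'.marginal i) := by
  simpa only [P2.marginal_eq_map] using h.map (PiLp.proj 2 (fun _ : Fin N => Rd d) i)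

theorem mem_Bar_weighted_empirical_iff {μ : P2 (RdN d N)} {ν : P2 (Rd d)} :
    ν ∈ Bar (weighted lam (empirical μ)) ↔
      ∀ ν', ∑ i, ENNReal.ofReal (lam (μ.marginal i)) * W2 (μ.marginal i) ν ^ 2 ≤
        ∑ i, ENNReal.ofReal (lam (μ.marginal i)) * W2 (μ.marginal i) ν' ^ 2 := by
  have hmeas : Measurable fun σ => ENNReal.ofReal (lam σ) :=
    (ENNReal.continuous_ofReal.comp lam.continuous).measurable
  have hint (ν : P2 (Rd d)) : ∫⁻ σ, W2 σ ν ^ 2 ∂(weighted lam (empirical μ)) =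
      (N : ℝ≥0∞)⁻¹ * ∑ i, ENNReal.ofReal (lam (μ.marginal i)) * W2 (μ.marginal i) ν ^ 2 := by
    rw [weighted, lintegral_withDensity_eq_lintegral_mul_non_measurable _ hmeas (by simp),
      empirical, lintegral_smul_measure, lintegral_finsetSum_measure]
    simp
  simp only [Bar, Set.mem_ofPred_eq, isMinOn_univ_iff, hint]
  -- For `N = 0` the factor `(N : ℝ≥0∞)⁻¹` is `⊤` and cannot be cancelled, but both sums are empty.
  rcases Nat.eq_zero_or_pos N with rfl | hN
  · simp
  · refine forall_congr' fun ν' => ?_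
    exact ENNReal.mul_le_mul_iff_right (by simp) (by simpa using hN.ne')

theorem mem_Bar_of_convergesW2 {μ : ℕ → P2 (RdN d N)} {μ' : P2 (RdN d N)} {ν : ℕ → P2 (Rd d)}
    {ν' : P2 (Rd d)} (hμ : ConvergesW2 μ μ') (hν : ConvergesW2 ν ν')
    (h : ∀ n, ν n ∈ Bar (weighted lam (empirical (μ n)))) :
    ν' ∈ Bar (weighted lam (empirical μ')) := by
  have hlim {σ : ℕ → P2 (Rd d)} {σ' : P2 (Rd d)} (hσ : ConvergesW2 σ σ') :
      Tendsto (fun n => ∑ i, ENNReal.ofReal (lam ((μ n).marginal i)) *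
        W2 ((μ n).marginal i) (σ n) ^ 2) atTop
        (𝓝 (∑ i, ENNReal.ofReal (lam (μ'.marginal i)) * W2 (μ'.marginal i) σ' ^ 2)) := by
    refine tendsto_finsetSum _ fun i _ => ?_
    refine ENNReal.Tendsto.mul ?_ (Or.inr (ENNReal.pow_ne_top (W2_ne_top _ _)))
      (ENNReal.Tendsto.pow ((hμ.marginal i).tendsto_W2 hσ)) (Or.inr ENNReal.ofReal_ne_top)
    exact ENNReal.tendsto_ofReal ((lam.continuous.tendsto _).comp (hμ.marginal i).tendsto)
  rw [mem_Bar_weighted_empirical_iff]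
  intro σ
  exact le_of_tendsto_of_tendsto' (hlim hν) (hlim (convergesW2_const σ)) fun n =>
    mem_Bar_weighted_empirical_iff.1 (h n) σ

end Barycenter

/-! ### Transport plans read off from measures on the tangent bundle. -/

section TangentPlans

variable {d N : ℕ}

/-- The base point of the `i`-th component of a tangent vector of `(ℝᵈ)ᴺ`. -/
noncomputable def basePoint (i : Fin N) : TRdN d N →L[ℝ] Rd d :=
  (PiLp.proj 2 (fun _ : Fin N => Rd d) i).comp (WithLp.fstL 2 ℝ (RdN d N) (RdN d N))

/-- The velocity of the `i`-th component of a tangent vector of `(ℝᵈ)ᴺ`. -/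
noncomputable def velocity (i : Fin N) : TRdN d N →L[ℝ] Rd d :=
  (PiLp.proj 2 (fun _ : Fin N => Rd d) i).comp (WithLp.sndL 2 ℝ (RdN d N) (RdN d N))

/-- The end point `x + v` of the `i`-th component of a tangent vector `(x, v)` of `(ℝᵈ)ᴺ`. -/
noncomputable def endPoint (i : Fin N) : TRdN d N →L[ℝ] Rd d :=
  basePoint i + velocity i

theorem endPoint_apply (i : Fin N) (z : TRdN d N) :
    endPoint i z = basePoint i z + velocity i z :=
  rfl

/-- The transport plan of the `i`-th component of a measure on `T(ℝᵈ)ᴺ`. -/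
noncomputable def componentPlan (ρ : Measure (TRdN d N)) (i : Fin N) : Measure (Rd d × Rd d) :=
  ρ.map fun z => (basePoint i z, endPoint i z)

theorem velocityPlan_componentPlan (ρ : Measure (TRdN d N)) (i : Fin N) :
    velocityPlan (componentPlan ρ i) = ρ.map fun z => (basePoint i z, velocity i z) := by
  rw [velocityPlan, componentPlan, Measure.map_map (by fun_prop) (by fun_prop)]
  congr 1
  ext z : 1
  simp [endPoint_apply]

theorem continuous_tangentIdent : Continuous (tangentIdent (d := d) (N := N)) := by
  unfold tangentIdent
  fun_prop

/-- The shear $(x,v)\mapsto(x,x+v)$ undoes `velocityPlan`, and the factors of a product of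
probability measures are its marginals. -/
theorem componentPlan_tensor (γ : Fin N → Measure (Rd d × Rd d))
    [∀ i, IsProbabilityMeasure (γ i)] (i : Fin N) :
    componentPlan (tensor fun i => velocityPlan (γ i)) i = γ i := by
  have (i : Fin N) : IsProbabilityMeasure (velocityPlan (γ i)) :=
    Measure.isProbabilityMeasure_map (by fun_prop)
  have hT := continuous_tangentIdent (d := d) (N := N)
  have hmp := measurePreserving_eval (fun i => velocityPlan (γ i)) i
  have hadd : Measurable fun p : Rd d × Rd d => (p.1, p.1 + p.2) := by fun_prop
  rw [componentPlan, tensor, Measure.map_map (by fun_prop) hT.measurable]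
  refine (Measure.map_map hadd hmp.measurable).symm.trans ?_
  rw [hmp.map_eq, velocityPlan, Measure.map_map hadd (by fun_prop)]
  convert Measure.map_id
  ext p : 1
  simp

/-- The displacement of the plan is the velocity up to sign, so its cost is the second moment of the
velocity marginal. -/
theorem componentPlan_mem_optimalCouplings_iff {ρ : P2 (TRdN d N)} {i : Fin N} {μ ν : P2 (Rd d)} :
    componentPlan ρ.toMeasure i ∈ optimalCouplings μ ν ↔
      ρ.map (basePoint i) = μ ∧ ρ.map (endPoint i) = ν ∧
        W2 (ρ.map (velocity i)) P2.diracZero ≤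
          W2 (ρ.map (basePoint i)) (ρ.map (endPoint i)) := by
  have hcoup : componentPlan ρ.toMeasure i ∈ couplings μ ν ↔
      ρ.map (basePoint i) = μ ∧ ρ.map (endPoint i) = ν := by
    rw [P2.ext_iff, P2.ext_iff, couplings, Set.mem_ofPred_eq, componentPlan,
      Measure.map_map (by fun_prop) (by fun_prop), Measure.map_map (by fun_prop) (by fun_prop)]
    rfl
  have hcost : eLpNorm (fun p : Rd d × Rd d => p.1 - p.2) 2 (componentPlan ρ.toMeasure i) =
      W2 (ρ.map (velocity i)) P2.diracZero := by
    rw [W2_diracZero, componentPlan, P2.map, eLpNorm_map_measure (by fun_prop) (by fun_prop),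
      eLpNorm_map_measure (by fun_prop) (by fun_prop)]
    refine eLpNorm_congr_norm_ae (.of_forall fun z => ?_)
    simp [endPoint_apply]
  rw [mem_optimalCouplings_iff, hcoup, hcost, and_assoc]
  constructor
  · rintro ⟨rfl, rfl, h⟩
    exact ⟨rfl, rfl, h⟩
  · rintro ⟨rfl, rfl, h⟩
    exact ⟨rfl, rfl, h⟩

theorem componentPlan_mem_optimalCouplings_of_convergesW2 {ρ : ℕ → P2 (TRdN d N)}
    {ρ' : P2 (TRdN d N)} (hρ : ConvergesW2 ρ ρ') {i : Fin N} {μ ν : ℕ → P2 (Rd d)}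
    {μ' : P2 (Rd d)} (hμ : ConvergesW2 μ μ')
    (h : ∀ n, componentPlan (ρ n).toMeasure i ∈ optimalCouplings (μ n) (ν n)) :
    componentPlan ρ'.toMeasure i ∈ optimalCouplings μ' (ρ'.map (endPoint i)) ∧
      ConvergesW2 ν (ρ'.map (endPoint i)) := by
  simp only [componentPlan_mem_optimalCouplings_iff] at h ⊢
  obtain rfl : (fun n => (ρ n).map (basePoint i)) = μ := funext fun n => (h n).1
  obtain rfl : (fun n => (ρ n).map (endPoint i)) = ν := funext fun n => (h n).2.1
  refine ⟨⟨(hρ.map _).unique hμ, trivial, ?_⟩, hρ.map _⟩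
  exact le_of_tendsto_of_tendsto' ((hρ.map _).tendsto_W2 (convergesW2_const _))
    ((hρ.map _).tendsto_W2 (hρ.map _)) fun n => (h n).2.2

theorem eq_tensor_of_convergesW2 {ρ : ℕ → P2 (TRdN d N)} {ρ' : P2 (TRdN d N)}
    (hρ : ConvergesW2 ρ ρ')
    (h : ∀ n, (ρ n).toMeasure =
      tensor fun i => velocityPlan (componentPlan (ρ n).toMeasure i)) :
    ρ'.toMeasure = tensor fun i => velocityPlan (componentPlan ρ'.toMeasure i) := by
  simp only [velocityPlan_componentPlan] at h ⊢
  have hT := continuous_tangentIdent (d := d) (N := N)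
  -- `F` replaces a measure by the product of its components; products and images under continuous
  -- maps are weakly continuous.
  let F : ProbabilityMeasure (TRdN d N) → ProbabilityMeasure (TRdN d N) := fun ρ =>
    (ProbabilityMeasure.pi fun i : Fin N => ρ.map
      (f := fun z => (basePoint i z, velocity i z)) (by fun_prop)).map hT.aemeasurable
  have hF : Continuous F :=
    (ProbabilityMeasure.continuous_map hT).comp <| ProbabilityMeasure.continuous_pi.comp <|
      continuous_pi fun i => ProbabilityMeasure.continuous_map (by fun_prop)
  have hlim := hρ.tendsto_toProbabilityMeasure
  have hFlim := (hF.tendsto _).comp hlim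
  have heq : ρ'.toProbabilityMeasure = F ρ'.toProbabilityMeasure :=
    tendsto_nhds_unique hlim (hFlim.congr fun n => Subtype.ext (h n).symm)
  exact congrArg Subtype.val heq

end TangentPlans

/-! ### Closedness of the graphs. -/

section VectorFields

variable {d N : ℕ} {lam : P2 (Rd d) →ᵇ ℝ}

theorem mem_multiVF_iff {μ : P2 (RdN d N)} {ρ : P2 (TRdN d N)} :
    ρ ∈ multiVF lam μ ↔
      (∀ i, ∃ ν ∈ Bar (weighted lam (empirical μ)),
        componentPlan ρ.toMeasure i ∈ optimalCouplings (μ.marginal i) ν) ∧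
      ρ.toMeasure = tensor fun i => velocityPlan (componentPlan ρ.toMeasure i) := by
  simp only [multiVF, optimalCouplingsSet, Set.mem_ofPred_eq, Set.mem_iUnion, exists_prop]
  refine ⟨?_, fun h => ⟨_, h⟩⟩
  rintro ⟨γ, hγ, hρ⟩
  have (i : Fin N) : IsProbabilityMeasure (γ i) :=
    let ⟨_, _, h⟩ := hγ i
    isProbabilityMeasure_of_mem_couplings h.1
  have hplan : componentPlan ρ.toMeasure = γ := by
    rw [hρ]
    exact funext (componentPlan_tensor γ)
  rw [hplan]
  exact ⟨hγ, hρ⟩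

theorem mem_multiVFCommon_iff {μ : P2 (RdN d N)} {ρ : P2 (TRdN d N)} :
    ρ ∈ multiVFCommon lam μ ↔
      ∃ ν ∈ Bar (weighted lam (empirical μ)),
        (∀ i, componentPlan ρ.toMeasure i ∈ optimalCouplings (μ.marginal i) ν) ∧
        ρ.toMeasure = tensor fun i => velocityPlan (componentPlan ρ.toMeasure i) := by
  refine exists_congr fun ν => and_congr_right fun _ => ⟨?_, fun h => ⟨_, h⟩⟩
  rintro ⟨γ, hγ, hρ⟩
  have (i : Fin N) : IsProbabilityMeasure (γ i) :=
    isProbabilityMeasure_of_mem_couplings (hγ i).1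
  have hplan : componentPlan ρ.toMeasure = γ := by
    rw [hρ]
    exact funext (componentPlan_tensor γ)
  rw [hplan]
  exact ⟨hγ, hρ⟩

theorem upperSemicontinuousMV_multiVF : UpperSemicontinuousMV (multiVF (N := N) lam) := by
  intro μ ρ μ' ρ' hμ hρ h
  simp only [mem_multiVF_iff] at h ⊢
  refine ⟨fun i => ?_, eq_tensor_of_convergesW2 hρ fun n => (h n).2⟩
  choose ν hν hopt using fun n => (h n).1 i
  obtain ⟨hlim, hconv⟩ := componentPlan_mem_optimalCouplings_of_convergesW2 hρ
    (hμ.marginal i) hopt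
  exact ⟨_, mem_Bar_of_convergesW2 hμ hconv hν, hlim⟩

theorem upperSemicontinuousMV_multiVFCommon :
    UpperSemicontinuousMV (multiVFCommon (N := N) lam) := by
  intro μ ρ μ' ρ' hμ hρ h
  simp only [mem_multiVFCommon_iff] at h ⊢
  choose ν hν hopt hprod using h
  have key (i : Fin N) := componentPlan_mem_optimalCouplings_of_convergesW2 hρ
    (hμ.marginal i) fun n => hopt n i
  have hprod' := eq_tensor_of_convergesW2 hρ hprod
  rcases isEmpty_or_nonempty (Fin N) with hN | ⟨⟨j⟩⟩
  -- Without agents no end point supplies a barycenter, but every measure is one.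
  · exact ⟨P2.diracZero, mem_Bar_weighted_empirical_iff.2 (by simp), hN.elim, hprod'⟩
  · refine ⟨_, mem_Bar_of_convergesW2 hμ (key j).2 hν, fun i => ?_, hprod'⟩
    -- The end-point marginals of all agents are limits of the same sequence `ν`, hence equal.
    rw [(key j).2.unique (key i).2]
    exact (key i).1

end VectorFields

/-- The multivalued probability vector field `𝒱` is upper semicontinuous, whether the barycenter is
chosen separately for each agent or is common to all agents. -/
theorem proposition3p1 (d N : ℕ) (lam : P2 (Rd d) →ᵇ ℝ) (hlam : ∀ σ, 0 < lam σ) :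
    UpperSemicontinuousMV (multiVF (N := N) lam) ∧
      UpperSemicontinuousMV (multiVFCommon (N := N) lam) :=
  ⟨upperSemicontinuousMV_multiVF, upperSemicontinuousMV_multiVFCommon⟩
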